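/- Let $P$ and $Q$ be probability distributions on $\mathbf{R}^I$ and $\mathbf{R}^J$ with finite second moments and zero means. Let $\Pi(P,Q)$ be the set of couplings of $P$ and $Q$, i.e. of probability distributions on $\mathbf{R}^I\times\mathbf{R}^J$ with marginals $P$ and $Q$; for $\pi\in\Pi(P,Q)$ and $(X,Y)\sim\pi$, let $\sigma_\pi=(\mathbf{E}_\pi(X_iY_j))_{ij}$ be the cross-covariance matrix, and let $\mathcal{F}(P,Q)=\{\sigma_{\tilde\pi}:\tilde\pi\in\Pi(P,Q)\}\subset\mathbf{M}_{I,J}(\mathbf{R})$ be the covariance set. For every coupling $(X,Y)\sim\pi\in\Pi(P,Q)$ the following conditions are equivalent: (i) $\pi$ has extreme dependence, i.e. $\sigma_\pi$ lies on the topological boundary of $\mathcal{F}(P,Q)$ in $\mathbf{M}_{I,J}(\mathbf{R})$; (ii) there exists $M\in\mathbf{M}_{I,J}(\mathbf{R})\setminus\{0\}$ such that $$\mathrm{Tr}(M'\sigma_\pi)=\sup_{\tilde\pi\in\Pi(P,Q)}\mathrm{Tr}(M'\sigma_{\tilde\pi}),$$ or equivalently (for each such $M$) $$\mathbf{E}_\pi(X'MY)=\sup_{\tilde\pi\in\Pi(P,Q)}\mathbf{E}_{\tilde\pi}(X'MY);$$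 (iii) there exist $M\in\mathbf{M}_{I,J}(\mathbf{R})\setminus\{0\}$ and a proper convex function $u:\mathbf{R}^I\to(-\infty,+\infty]$ such that $MY\in\partial u(X)$ almost surely, where $\partial u(x_0)$ is the set of $v\in\mathbf{R}^I$ with $u(x)\ge u(x_0)+v\cdot(x-x_0)$ for all $x\in\mathbf{R}^I$ if $u(x_0)<+\infty$, and $\partial u(x_0)=\emptyset$ if $u(x_0)=+\infty$. -/

import Mathlib

open MeasureTheory Matrix

noncomputable section

/-- The couplings of `P` and `Q`: the probability distributions on `ℝᵐ × ℝⁿ` with marginals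
`P` and `Q`. -/
def couplings {m n : ℕ} (P : Measure (Fin m → ℝ)) (Q : Measure (Fin n → ℝ)) :
    Set (Measure ((Fin m → ℝ) × (Fin n → ℝ))) :=
  {π | IsProbabilityMeasure π ∧ π.map Prod.fst = P ∧ π.map Prod.snd = Q}

/-- The cross-covariance matrix `σ_π`, with entries `E_π (X_i Y_j)` (for centred marginals). -/
def crossCov {m n : ℕ} (π : Measure ((Fin m → ℝ) × (Fin n → ℝ))) : Matrix (Fin m) (Fin n) ℝ :=
  Matrix.of fun i j => ∫ p, p.1 i * p.2 j ∂π

/-- The covariance set `F(P, Q)`. -/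
def covarianceSet {m n : ℕ} (P : Measure (Fin m → ℝ)) (Q : Measure (Fin n → ℝ)) :
    Set (Matrix (Fin m) (Fin n) ℝ) :=
  {S | ∃ π ∈ couplings P Q, ∀ i j, S i j = ∫ p, p.1 i * p.2 j ∂π}

/-- A coupling has extreme dependence if its cross-covariance matrix lies on the (topological)
boundary of the covariance set in the space of real `m × n` matrices. -/
def ExtremeDependence {m n : ℕ} (P : Measure (Fin m → ℝ)) (Q : Measure (Fin n → ℝ))
    (π : Measure ((Fin m → ℝ) × (Fin n → ℝ))) : Prop :=
  crossCov π ∈ frontier (covarianceSet P Q)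

/-- Proper convex functions `u : ℝᵐ → (-∞, +∞]`: the epigraph is convex, the value `-∞` is
never taken, and `u` is finite somewhere. -/
structure IsProperConvex {m : ℕ} (u : (Fin m → ℝ) → EReal) : Prop where
  convex_epigraph : Convex ℝ {p : (Fin m → ℝ) × ℝ | u p.1 ≤ (p.2 : EReal)}
  ne_bot : ∀ x, u x ≠ ⊥
  exists_ne_top : ∃ x, u x ≠ ⊤

/-- The subdifferential of `u` at `x₀`, empty where `u` is not finite. -/
def subdifferential {m : ℕ} (u : (Fin m → ℝ) → EReal) (x₀ : Fin m → ℝ) : Set (Fin m → ℝ) :=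
  {v | u x₀ ≠ ⊥ ∧ u x₀ ≠ ⊤ ∧ ∀ x, u x₀ + ((v ⬝ᵥ (x - x₀) : ℝ) : EReal) ≤ u x}

end

open scoped ProbabilityTheory

/-! ### Convexity of the covariance set and supporting functionals. -/

section

/-! Mixtures of couplings are couplings, so the covariance set is convex, and one of its points lies
on the boundary exactly when a nonzero linear functional, necessarily of the form `S ↦ Tr(M' S)`, is
maximal there. Since `Tr(M' σ_π) = E_π(X' M Y)`, this says that `π` solves the optimal transport
problem with bilinear reward.

An optimal `π` cannot gain by exchanging small masses near finitely many points of its support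
(`sum_cost_perm_le_of_optimal`). Hence the image of the support under `(x, y) ↦ (x, M y)` is
cyclically monotone, and Rockafellar's construction gives `u`
(`exists_isProperConvex_mem_subdifferential`). Conversely, `M Y ∈ ∂u(X)` turns Young's inequality
into an almost sure equality; the conjugate potentials, whose expectations depend only on the
marginals, then certify optimality (`integral_le_of_mem_subdifferential`). -/

theorem Convex.mem_frontier_iff_exists_support {E : Type*} [NormedAddCommGroup E]
    [NormedSpace ℝ E] [FiniteDimensional ℝ E] {s : Set E} (hs : Convex ℝ s) {x : E} (hx : x ∈ s) :
    x ∈ frontier s ↔ ∃ f : E →ₗ[ℝ] ℝ, f ≠ 0 ∧ ∀ y ∈ s, f y ≤ f x := by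
  have hfr : x ∈ frontier s ↔ x ∉ interior s := by
    rw [frontier, Set.mem_sdiff]
    exact and_iff_right (subset_closure hx)
  rw [hfr]
  constructor
  · intro hxi
    by_cases hne : (interior s).Nonempty
    · obtain ⟨f, hf⟩ := geometric_hahn_banach_open_point hs.interior isOpen_interior hxi
      refine ⟨f.toLinearMap, ?_, ?_⟩
      · rintro h0
        obtain ⟨a, ha⟩ := hne
        have h1 := hf a ha
        have h2 : ∀ z, f z = 0 := fun z => LinearMap.congr_fun h0 z
        simp [h2] at h1
      · intro y hy
        have hcl : y ∈ closure (interior s) := by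
          rw [hs.closure_interior_eq_closure_of_nonempty_interior hne]
          exact subset_closure hy
        have hsub : interior s ⊆ {z | f z ≤ f x} := fun a ha => (hf a ha).le
        exact closure_minimal hsub (isClosed_le f.continuous continuous_const) hcl
    -- Empty interior: the set lies in a proper affine subspace, and a functional vanishing on its
    -- direction is constant on the set.
    · rw [hs.interior_nonempty_iff_affineSpan_eq_top] at hne
      have hdir : (affineSpan ℝ s).direction < ⊤ := by
        refine lt_top_iff_ne_top.2 fun h => hne ?_
        exact (AffineSubspace.direction_eq_top_iff_of_nonempty
          ⟨x, subset_affineSpan ℝ s hx⟩).1 h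
      obtain ⟨f, hf0, hf⟩ := Submodule.exists_le_ker_of_lt_top _ hdir
      refine ⟨f, hf0, fun y hy => ?_⟩
      have hmem : y -ᵥ x ∈ (affineSpan ℝ s).direction :=
        AffineSubspace.vsub_mem_direction (subset_affineSpan ℝ s hy) (subset_affineSpan ℝ s hx)
      have h0 : f (y - x) = 0 := hf hmem
      rw [map_sub] at h0
      linarith
  · rintro ⟨f, hf0, hf⟩ hxi
    obtain ⟨v, hv⟩ : ∃ v, 0 < f v := by
      by_contra! h
      refine hf0 (LinearMap.ext fun v => le_antisymm (h v) ?_)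
      have := h (-v)
      simpa using this
    -- From an interior point, a small step along `v` stays in the set and increases `f`.
    have hcont : ContinuousAt (fun t : ℝ => x + t • v) 0 := by fun_prop
    have hev : ∀ᶠ t : ℝ in nhds 0, x + t • v ∈ s := by
      apply hcont
      simpa using mem_interior_iff_mem_nhds.1 hxi
    obtain ⟨t, ht, ht0⟩ := ((hev.filter_mono nhdsWithin_le_nhds).and
      (self_mem_nhdsWithin : Set.Ioi (0 : ℝ) ∈ nhdsWithin 0 (Set.Ioi 0))).exists
    have h1 := hf _ ht
    rw [map_add, map_smul, smul_eq_mul] at h1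
    have h2 : 0 < t * f v := mul_pos ht0 hv
    linarith

variable {m n : ℕ} {P : Measure (Fin m → ℝ)} {Q : Measure (Fin n → ℝ)}
  {π : Measure ((Fin m → ℝ) × (Fin n → ℝ))}

theorem measurePreserving_fst_of_mem_couplings (hπ : π ∈ couplings P Q) :
    MeasurePreserving Prod.fst π P := ⟨measurable_fst, hπ.2.1⟩

theorem measurePreserving_snd_of_mem_couplings (hπ : π ∈ couplings P Q) :
    MeasurePreserving Prod.snd π Q := ⟨measurable_snd, hπ.2.2⟩

theorem memLp_fst_apply (hP : ∀ i, MemLp (fun x : Fin m → ℝ => x i) 2 P)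
    (hπ : π ∈ couplings P Q) (i : Fin m) :
    MemLp (fun p : (Fin m → ℝ) × (Fin n → ℝ) => p.1 i) 2 π :=
  (hP i).comp_measurePreserving (measurePreserving_fst_of_mem_couplings hπ)

theorem memLp_snd_apply (hQ : ∀ j, MemLp (fun y : Fin n → ℝ => y j) 2 Q)
    (hπ : π ∈ couplings P Q) (j : Fin n) :
    MemLp (fun p : (Fin m → ℝ) × (Fin n → ℝ) => p.2 j) 2 π :=
  (hQ j).comp_measurePreserving (measurePreserving_snd_of_mem_couplings hπ)

theorem integrable_fst_mul_snd (hP : ∀ i, MemLp (fun x : Fin m → ℝ => x i) 2 P)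
    (hQ : ∀ j, MemLp (fun y : Fin n → ℝ => y j) 2 Q) (hπ : π ∈ couplings P Q)
    (i : Fin m) (j : Fin n) :
    Integrable (fun p : (Fin m → ℝ) × (Fin n → ℝ) => p.1 i * p.2 j) π :=
  (memLp_fst_apply hP hπ i).integrable_mul (memLp_snd_apply hQ hπ j)

theorem dotProduct_mulVec_eq_sum (M : Matrix (Fin m) (Fin n) ℝ) (x : Fin m → ℝ) (y : Fin n → ℝ) :
    x ⬝ᵥ (M *ᵥ y) = ∑ i, ∑ j, M i j * (x i * y j) := by
  simp only [dotProduct, mulVec, Finset.mul_sum]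
  exact Finset.sum_congr rfl fun i _ => Finset.sum_congr rfl fun j _ => by ring

theorem trace_transpose_mul_eq_sum (M S : Matrix (Fin m) (Fin n) ℝ) :
    (Mᵀ * S).trace = ∑ i, ∑ j, M i j * S i j := by
  simp only [trace, diag, mul_apply, transpose_apply]
  exact Finset.sum_comm

theorem integrable_dotProduct_mulVec (hP : ∀ i, MemLp (fun x : Fin m → ℝ => x i) 2 P)
    (hQ : ∀ j, MemLp (fun y : Fin n → ℝ => y j) 2 Q) (hπ : π ∈ couplings P Q)
    (M : Matrix (Fin m) (Fin n) ℝ) :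
    Integrable (fun p : (Fin m → ℝ) × (Fin n → ℝ) => p.1 ⬝ᵥ (M *ᵥ p.2)) π := by
  simp only [dotProduct_mulVec_eq_sum]
  exact integrable_finsetSum _ fun i _ => integrable_finsetSum _ fun j _ =>
    (integrable_fst_mul_snd hP hQ hπ i j).const_mul _

theorem trace_mul_crossCov (hP : ∀ i, MemLp (fun x : Fin m → ℝ => x i) 2 P)
    (hQ : ∀ j, MemLp (fun y : Fin n → ℝ => y j) 2 Q) (hπ : π ∈ couplings P Q)
    (M : Matrix (Fin m) (Fin n) ℝ) :
    (Mᵀ * crossCov π).trace = ∫ p, p.1 ⬝ᵥ (M *ᵥ p.2) ∂π := by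
  simp only [dotProduct_mulVec_eq_sum, trace_transpose_mul_eq_sum, crossCov, of_apply]
  have hint := fun i j => (integrable_fst_mul_snd hP hQ hπ i j).const_mul (M i j)
  rw [integral_finsetSum _ fun i _ => integrable_finsetSum _ fun j _ => hint i j]
  refine Finset.sum_congr rfl fun i _ => ?_
  rw [integral_finsetSum _ fun j _ => hint i j]
  exact Finset.sum_congr rfl fun j _ => (integral_const_mul _ _).symm

theorem isLUB_image_iff_of_mem {α : Type*} {s : Set α} {f : α → ℝ} {a : α} (ha : a ∈ s) :
    IsLUB (f '' s) (f a) ↔ ∀ b ∈ s, f b ≤ f a := by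
  constructor
  · exact fun h b hb => h.1 (Set.mem_image_of_mem f hb)
  · intro h
    refine ⟨?_, fun c hc => hc (Set.mem_image_of_mem f ha)⟩
    rintro _ ⟨b, hb, rfl⟩
    exact h b hb

theorem mem_covarianceSet_iff {S : Matrix (Fin m) (Fin n) ℝ} :
    S ∈ covarianceSet P Q ↔ ∃ π ∈ couplings P Q, crossCov π = S := by
  refine exists_congr fun π => and_congr_right fun _ => ?_
  rw [← Matrix.ext_iff]
  exact forall₂_congr fun i j => eq_comm

theorem convex_combination_mem_couplings [IsProbabilityMeasure P] [IsProbabilityMeasure Q]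
    {π' : Measure ((Fin m → ℝ) × (Fin n → ℝ))} (hπ : π ∈ couplings P Q)
    (hπ' : π' ∈ couplings P Q) {a b : ENNReal} (hab : a + b = 1) :
    a • π + b • π' ∈ couplings P Q := by
  have := hπ.1
  have := hπ'.1
  refine ⟨⟨by simp [hab]⟩, ?_, ?_⟩
  · rw [Measure.map_add _ _ measurable_fst, Measure.map_smul, Measure.map_smul, hπ.2.1, hπ'.2.1,
      ← add_smul, hab, one_smul]
  · rw [Measure.map_add _ _ measurable_snd, Measure.map_smul, Measure.map_smul, hπ.2.2, hπ'.2.2,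
      ← add_smul, hab, one_smul]

theorem convex_covarianceSet [IsProbabilityMeasure P] [IsProbabilityMeasure Q]
    (hP : ∀ i, MemLp (fun x : Fin m → ℝ => x i) 2 P)
    (hQ : ∀ j, MemLp (fun y : Fin n → ℝ => y j) 2 Q) :
    Convex ℝ (covarianceSet P Q) := by
  rintro S ⟨π, hπ, hS⟩ S' ⟨π', hπ', hS'⟩ a b ha hb hab
  refine ⟨ENNReal.ofReal a • π + ENNReal.ofReal b • π',
    convex_combination_mem_couplings hπ hπ' ?_, fun i j => ?_⟩
  · rw [← ENNReal.ofReal_add ha hb, hab, ENNReal.ofReal_one]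
  · have h1 := (integrable_fst_mul_snd hP hQ hπ i j).smul_measure
      (ENNReal.ofReal_ne_top (r := a))
    have h2 := (integrable_fst_mul_snd hP hQ hπ' i j).smul_measure
      (ENNReal.ofReal_ne_top (r := b))
    rw [integral_add_measure h1 h2, integral_smul_measure, integral_smul_measure,
      ENNReal.toReal_ofReal ha, ENNReal.toReal_ofReal hb, ← hS i j, ← hS' i j]
    rfl

theorem exists_trace_eq_of_linearMap (f : Matrix (Fin m) (Fin n) ℝ →ₗ[ℝ] ℝ) :
    ∃ M : Matrix (Fin m) (Fin n) ℝ, ∀ S, f S = (Mᵀ * S).trace := by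
  refine ⟨of fun i j => f (single i j 1), fun S => ?_⟩
  conv_lhs => rw [matrix_eq_sum_single S]
  rw [trace_transpose_mul_eq_sum, map_sum]
  refine Finset.sum_congr rfl fun i _ => ?_
  rw [map_sum]
  refine Finset.sum_congr rfl fun j _ => ?_
  have : single i j (S i j) = S i j • single i j (1 : ℝ) := by simp
  rw [this, map_smul, smul_eq_mul, mul_comm, of_apply]

theorem Convex.mem_frontier_iff_exists_trace_le {s : Set (Matrix (Fin m) (Fin n) ℝ)}
    (hs : Convex ℝ s) {S : Matrix (Fin m) (Fin n) ℝ} (hS : S ∈ s) :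
    S ∈ frontier s ↔ ∃ M : Matrix (Fin m) (Fin n) ℝ, M ≠ 0 ∧
      ∀ T ∈ s, (Mᵀ * T).trace ≤ (Mᵀ * S).trace := by
  have key : S ∈ frontier s ↔ ∃ f : Matrix (Fin m) (Fin n) ℝ →ₗ[ℝ] ℝ, f ≠ 0 ∧
      ∀ T ∈ s, f T ≤ f S :=
    -- Matrices carry the product topology, so the boundary can be taken in the normed function
    -- space.
    Convex.mem_frontier_iff_exists_support (E := Fin m → Fin n → ℝ) hs hS
  rw [key]
  constructor
  · rintro ⟨f, hf0, hf⟩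
    obtain ⟨M, hM⟩ := exists_trace_eq_of_linearMap f
    refine ⟨M, ?_, fun T hT => ?_⟩
    · rintro rfl
      exact hf0 (LinearMap.ext fun T => by simp [hM])
    · rw [← hM, ← hM]
      exact hf T hT
  · rintro ⟨M, hM0, hM⟩
    refine ⟨⟨⟨fun T => (Mᵀ * T).trace, fun T T' => by rw [Matrix.mul_add, trace_add]⟩,
      fun a T => by simp⟩, fun h0 => hM0 ?_, hM⟩
    have h : ∀ T : Matrix (Fin m) (Fin n) ℝ, (Mᵀ * T).trace = 0 := fun T => LinearMap.congr_fun h0 T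
    rw [← transpose_eq_zero, ext_iff_trace_mul_right]
    intro T
    rw [h T, Matrix.zero_mul, trace_zero]

theorem extremeDependence_iff [IsProbabilityMeasure P] [IsProbabilityMeasure Q]
    (hP : ∀ i, MemLp (fun x : Fin m → ℝ => x i) 2 P)
    (hQ : ∀ j, MemLp (fun y : Fin n → ℝ => y j) 2 Q) (hπ : π ∈ couplings P Q) :
    ExtremeDependence P Q π ↔ ∃ M : Matrix (Fin m) (Fin n) ℝ, M ≠ 0 ∧
      ∀ π' ∈ couplings P Q, (Mᵀ * crossCov π').trace ≤ (Mᵀ * crossCov π).trace := by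
  refine ((convex_covarianceSet hP hQ).mem_frontier_iff_exists_trace_le
    (mem_covarianceSet_iff.2 ⟨π, hπ, rfl⟩)).trans ?_
  refine exists_congr fun M => and_congr_right fun _ => ?_
  constructor
  · exact fun h π' hπ' => h _ (mem_covarianceSet_iff.2 ⟨π', hπ', rfl⟩)
  · intro h T hT
    obtain ⟨π', hπ', rfl⟩ := mem_covarianceSet_iff.1 hT
    exact h π' hπ'

end

/-! ### Optimal couplings and permutations of points of the support. -/

section

theorem exists_radius_forall_ball {E F ι : Type*} [PseudoMetricSpace E] [PseudoMetricSpace F]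
    [Finite ι] {c : E × F → ℝ} (hc : Continuous c) (p : ι → E × F) {δ : ℝ} (hδ : 0 < δ) :
    ∃ r > 0, ∀ a b : ι, ∀ q : E × F, dist q.1 (p a).1 < r → dist q.2 (p b).2 < r →
      |c q - c ((p a).1, (p b).2)| < δ := by
  have h : ∀ a b : ι, ∀ᶠ r in nhdsWithin (0 : ℝ) (Set.Ioi 0), ∀ q : E × F,
      dist q.1 (p a).1 < r → dist q.2 (p b).2 < r → |c q - c ((p a).1, (p b).2)| < δ := by
    intro a b
    obtain ⟨r, hr, h⟩ := Metric.continuous_iff.1 hc ((p a).1, (p b).2) δ hδ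
    filter_upwards [Ioo_mem_nhdsGT hr] with s hs q h1 h2
    exact h q (max_lt (h1.trans hs.2) (h2.trans hs.2))
  obtain ⟨r, hr, hr0⟩ := ((Filter.eventually_all.2 fun a => Filter.eventually_all.2 (h a)).and
    self_mem_nhdsWithin).exists
  exact ⟨r, hr0, hr⟩

theorem le_integral_of_ae_le {α : Type*} [MeasurableSpace α] {μ : Measure α}
    [IsProbabilityMeasure μ] {f : α → ℝ} (hf : Integrable f μ) {a : ℝ} (h : ∀ᵐ x ∂μ, a ≤ f x) :
    a ≤ ∫ x, f x ∂μ := by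
  have := integral_mono_ae (integrable_const a) hf h
  simpa using this

theorem integral_le_of_ae_le {α : Type*} [MeasurableSpace α] {μ : Measure α}
    [IsProbabilityMeasure μ] {f : α → ℝ} (hf : Integrable f μ) {a : ℝ} (h : ∀ᵐ x ∂μ, f x ≤ a) :
    ∫ x, f x ∂μ ≤ a := by
  have := integral_mono_ae hf (integrable_const a) h
  simpa using this

/-- A finite family of conditionals of `μ` of a common small mass fits inside `μ`. -/
theorem exists_sum_smul_cond_le {α ι : Type*} [MeasurableSpace α] [Fintype ι] [Nonempty ι]
    (μ : Measure α) [IsFiniteMeasure μ] {A : ι → Set α} (hA : ∀ i, μ (A i) ≠ 0) :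
    ∃ ε : ENNReal, ε ≠ 0 ∧ ε ≠ ⊤ ∧ ∑ i, ε • μ[|A i] ≤ μ := by
  obtain ⟨i₀, hi₀⟩ := Finite.exists_min fun i => μ (A i)
  have hcard : (Fintype.card ι : ENNReal) ≠ 0 := by simp
  -- With the smallest mass divided by the number of sets, each summand is at most `μ` divided by
  -- that number, even if the sets overlap.
  refine ⟨(Fintype.card ι : ENNReal)⁻¹ * μ (A i₀), mul_ne_zero (by simp) (hA i₀),
    ENNReal.mul_ne_top (ENNReal.inv_ne_top.2 hcard) (measure_ne_top _ _), ?_⟩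
  have hi : ∀ i, ((Fintype.card ι : ENNReal)⁻¹ * μ (A i₀)) • μ[|A i]
      ≤ (Fintype.card ι : ENNReal)⁻¹ • μ := by
    intro i
    refine Measure.le_iff'.2 fun s => ?_
    simp only [Measure.smul_apply, smul_eq_mul, ProbabilityTheory.cond]
    calc (Fintype.card ι : ENNReal)⁻¹ * μ (A i₀) * ((μ (A i))⁻¹ * μ.restrict (A i) s)
        ≤ (Fintype.card ι : ENNReal)⁻¹ * μ (A i) * ((μ (A i))⁻¹ * μ s) := by
          exact mul_le_mul' (mul_le_mul' le_rfl (hi₀ i))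
            (mul_le_mul' le_rfl (Measure.restrict_apply_le _ _))
      _ = (Fintype.card ι : ENNReal)⁻¹ * μ s * (μ (A i) * (μ (A i))⁻¹) := by ring
      _ = (Fintype.card ι : ENNReal)⁻¹ * μ s := by
          rw [ENNReal.mul_inv_cancel (hA i) (measure_ne_top _ _), mul_one]
  calc ∑ i, ((Fintype.card ι : ENNReal)⁻¹ * μ (A i₀)) • μ[|A i]
      ≤ ∑ _i : ι, (Fintype.card ι : ENNReal)⁻¹ • μ := Finset.sum_le_sum fun i _ => hi i
    _ = μ := by
        rw [Finset.sum_const, Finset.card_univ, ← Nat.cast_smul_eq_nsmul ENNReal, smul_smul,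
          ENNReal.mul_inv_cancel hcard (by simp), one_smul]

variable {m n : ℕ} {P : Measure (Fin m → ℝ)} {Q : Measure (Fin n → ℝ)}
  {π : Measure ((Fin m → ℝ) × (Fin n → ℝ))}

/-- Recombining the marginals of the summands of a coupling along a permutation. -/
theorem add_sum_prod_mem_couplings {ι : Type*} [Fintype ι] (σ : Equiv.Perm ι)
    {ρ : Measure ((Fin m → ℝ) × (Fin n → ℝ))} {κ : ι → Measure ((Fin m → ℝ) × (Fin n → ℝ))}
    [∀ i, IsProbabilityMeasure (κ i)] {ε : ENNReal} (hπ : ρ + ∑ i, ε • κ i ∈ couplings P Q) :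
    ρ + ∑ i, ε • ((κ (σ i)).map Prod.fst).prod ((κ i).map Prod.snd) ∈ couplings P Q := by
  have hfst : ∀ i, IsProbabilityMeasure ((κ i).map Prod.fst) := fun i =>
    Measure.isProbabilityMeasure_map measurable_fst.aemeasurable
  have hsnd : ∀ i, IsProbabilityMeasure ((κ i).map Prod.snd) := fun i =>
    Measure.isProbabilityMeasure_map measurable_snd.aemeasurable
  have h1 := hπ.2.1
  have h2 := hπ.2.2
  rw [Measure.map_add _ _ measurable_fst, Measure.map_finset_sum measurable_fst.aemeasurable] at h1
  rw [Measure.map_add _ _ measurable_snd, Measure.map_finset_sum measurable_snd.aemeasurable] at h2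
  simp only [Measure.map_smul] at h1 h2
  refine ⟨⟨?_⟩, ?_, ?_⟩
  · rw [← hπ.1.measure_univ]
    simp
  · rw [Measure.map_add _ _ measurable_fst, Measure.map_finset_sum measurable_fst.aemeasurable,
      ← h1]
    simp only [Measure.map_smul, Measure.map_fst_prod, measure_univ, one_smul]
    rw [Equiv.sum_comp σ fun i => ε • (κ i).map Prod.fst]
  · rw [Measure.map_add _ _ measurable_snd, Measure.map_finset_sum measurable_snd.aemeasurable,
      ← h2]
    simp only [Measure.map_smul, Measure.map_snd_prod, measure_univ, one_smul]

/-- The two couplings share `ρ`, whose finite contribution cancels, as does the factor `ε`. Each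
piece inherits integrability from the coupling that contains it. -/
theorem sum_integral_prod_le_of_optimal {c : (Fin m → ℝ) × (Fin n → ℝ) → ℝ}
    (hint : ∀ π' ∈ couplings P Q, Integrable c π')
    (hopt : ∀ π' ∈ couplings P Q, ∫ q, c q ∂π' ≤ ∫ q, c q ∂π) {ι : Type*} [Fintype ι]
    (σ : Equiv.Perm ι) {ρ : Measure ((Fin m → ℝ) × (Fin n → ℝ))}
    {κ : ι → Measure ((Fin m → ℝ) × (Fin n → ℝ))} [∀ i, IsProbabilityMeasure (κ i)]
    {ε : ENNReal} (hε0 : ε ≠ 0) (hεt : ε ≠ ⊤) (hπ : ρ + ∑ i, ε • κ i ∈ couplings P Q)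
    (hdec : ρ + ∑ i, ε • κ i = π) :
    (∀ i, Integrable c (κ i)) ∧
    (∀ i, Integrable c (((κ (σ i)).map Prod.fst).prod ((κ i).map Prod.snd))) ∧
    ∑ i, ∫ q, c q ∂(((κ (σ i)).map Prod.fst).prod ((κ i).map Prod.snd)) ≤
      ∑ i, ∫ q, c q ∂(κ i) := by
  have hmem := add_sum_prod_mem_couplings σ hπ
  have hcomp := hopt _ hmem
  have hi1 := hint _ hπ
  have hi2 := hint _ hmem
  have hi1' := integrable_finsetSum_measure.1 hi1.right_of_add_measure
  have hi2' := integrable_finsetSum_measure.1 hi2.right_of_add_measure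
  refine ⟨fun i => (integrable_smul_measure hε0 hεt).1 (hi1' i (Finset.mem_univ i)),
    fun i => (integrable_smul_measure hε0 hεt).1 (hi2' i (Finset.mem_univ i)), ?_⟩
  rw [← hdec, integral_add_measure hi2.left_of_add_measure hi2.right_of_add_measure,
    integral_add_measure hi1.left_of_add_measure hi1.right_of_add_measure,
    integral_finsetSum_measure hi2', integral_finsetSum_measure hi1'] at hcomp
  simp only [integral_smul_measure, smul_eq_mul, ← Finset.mul_sum] at hcomp
  exact le_of_mul_le_mul_left (le_of_add_le_add_left hcomp) (ENNReal.toReal_pos hε0 hεt)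

theorem ae_prod_map_fst_map_snd {E F : Type*} [MeasurableSpace E] [MeasurableSpace F]
    {κ κ' : Measure (E × F)} [IsProbabilityMeasure κ] [IsProbabilityMeasure κ']
    {U : Set E} {V : Set F} (hU : MeasurableSet U) (hV : MeasurableSet V)
    (h : ∀ᵐ q ∂κ, q.1 ∈ U) (h' : ∀ᵐ q ∂κ', q.2 ∈ V) :
    ∀ᵐ q ∂((κ.map Prod.fst).prod (κ'.map Prod.snd)), q.1 ∈ U ∧ q.2 ∈ V := by
  have h1 : ∀ᵐ x ∂κ.map Prod.fst, x ∈ U := (ae_map_iff measurable_fst.aemeasurable hU).2 h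
  have h2 : ∀ᵐ y ∂κ'.map Prod.snd, y ∈ V := (ae_map_iff measurable_snd.aemeasurable hV).2 h'
  exact (Measure.quasiMeasurePreserving_fst.ae h1).and (Measure.quasiMeasurePreserving_snd.ae h2)

/-- Every ball around a support point has positive mass. If permuting the points raised the total,
then recombining the marginals of small conditionals of `π` on such balls would give a better
coupling. -/
theorem sum_cost_perm_le_of_optimal {c : (Fin m → ℝ) × (Fin n → ℝ) → ℝ} (hc : Continuous c)
    (hint : ∀ π' ∈ couplings P Q, Integrable c π') (hπ : π ∈ couplings P Q)
    (hopt : ∀ π' ∈ couplings P Q, ∫ q, c q ∂π' ≤ ∫ q, c q ∂π) {ι : Type*} [Fintype ι]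
    (σ : Equiv.Perm ι) {p : ι → (Fin m → ℝ) × (Fin n → ℝ)} (hp : ∀ i, p i ∈ π.support) :
    ∑ i, c ((p (σ i)).1, (p i).2) ≤ ∑ i, c (p i) := by
  have := hπ.1
  by_contra! hlt
  have hne : Nonempty ι := by
    by_contra h
    rw [not_nonempty_iff] at h
    simp at hlt
  set D := ∑ i, c ((p (σ i)).1, (p i).2) - ∑ i, c (p i) with hD
  have hD0 : 0 < D := sub_pos.2 hlt
  have hcard : (0 : ℝ) < Fintype.card ι := by exact_mod_cast Fintype.card_pos
  -- The errors before and after the exchange add up to at most `D / 2`, less than the supposed gain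
  -- `D`.
  set δ := D / (4 * Fintype.card ι) with hδ
  have hδ0 : 0 < δ := by positivity
  obtain ⟨r, hr, hball⟩ := exists_radius_forall_ball hc p hδ0
  obtain ⟨A, hAdef⟩ : ∃ A : ι → Set ((Fin m → ℝ) × (Fin n → ℝ)),
      ∀ i, A i = Metric.ball (p i) r := ⟨_, fun _ => rfl⟩
  have hAm : ∀ i, MeasurableSet (A i) := fun i => by
    rw [hAdef]
    exact measurableSet_ball
  have hAball : ∀ i, ∀ q ∈ A i, dist q.1 (p i).1 < r ∧ dist q.2 (p i).2 < r := fun i q hq => by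
    rw [hAdef, Metric.mem_ball] at hq
    exact ⟨(le_max_left _ _).trans_lt hq, (le_max_right _ _).trans_lt hq⟩
  have hA : ∀ i, π (A i) ≠ 0 := fun i => by
    rw [hAdef]
    exact ((Measure.mem_support_iff_forall _).1 (hp i) _ (Metric.ball_mem_nhds _ hr)).ne'
  obtain ⟨ε, hε0, hεt, hle⟩ := exists_sum_smul_cond_le π hA
  have hκ : ∀ i, IsProbabilityMeasure (π[|A i]) := fun i =>
    ProbabilityTheory.cond_isProbabilityMeasure (hA i)
  have hprod : ∀ i, IsProbabilityMeasure
      (((π[|A (σ i)]).map Prod.fst).prod ((π[|A i]).map Prod.snd)) := fun i => by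
    have := Measure.isProbabilityMeasure_map (μ := π[|A (σ i)]) measurable_fst.aemeasurable
    have := Measure.isProbabilityMeasure_map (μ := π[|A i]) measurable_snd.aemeasurable
    infer_instance
  have hfin : IsFiniteMeasure (∑ i, ε • π[|A i]) := isFiniteMeasure_of_le π hle
  have hdec := Measure.sub_add_cancel_of_le hle
  obtain ⟨hi1, hi2, hcomp⟩ := sum_integral_prod_le_of_optimal hint hopt σ hε0 hεt
    (by rwa [hdec]) hdec
  have hmem : ∀ i, ∀ᵐ q ∂π[|A i], q ∈ A i := fun i => ProbabilityTheory.ae_cond_mem (hAm i)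
  have hup : ∀ i, ∫ q, c q ∂(π[|A i]) ≤ c (p i) + δ := by
    intro i
    refine integral_le_of_ae_le (hi1 i) ((hmem i).mono fun q hq => ?_)
    have := hball i i q (hAball i q hq).1 (hAball i q hq).2
    linarith [(abs_lt.1 this).2]
  have hlow : ∀ i, c ((p (σ i)).1, (p i).2) - δ ≤
      ∫ q, c q ∂(((π[|A (σ i)]).map Prod.fst).prod ((π[|A i]).map Prod.snd)) := by
    intro i
    have hae := ae_prod_map_fst_map_snd (measurableSet_ball (x := (p (σ i)).1) (ε := r))
      (measurableSet_ball (x := (p i).2) (ε := r))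
      ((hmem (σ i)).mono fun q hq => (hAball _ q hq).1)
      ((hmem i).mono fun q hq => (hAball _ q hq).2)
    refine le_integral_of_ae_le (hi2 i) (hae.mono fun q hq => ?_)
    have := hball (σ i) i q hq.1 hq.2
    linarith [(abs_lt.1 this).1]
  have hsum1 := Finset.sum_le_sum fun i (_ : i ∈ Finset.univ) => hup i
  have hsum2 := Finset.sum_le_sum fun i (_ : i ∈ Finset.univ) => hlow i
  rw [Finset.sum_add_distrib, Finset.sum_const, Finset.card_univ, nsmul_eq_mul] at hsum1
  rw [Finset.sum_sub_distrib, Finset.sum_const, Finset.card_univ, nsmul_eq_mul] at hsum2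
  have hcδ : Fintype.card ι * δ = D / 4 := by
    rw [hδ]
    field_simp
  linarith

end

/-! ### Rockafellar's theorem on cyclically monotone sets. -/

section

variable {m n : ℕ}

/-- Cyclical monotonicity of a set of pairs, in terms of sequences with an arbitrary cut-off. -/
def IsCyclicallyMonotone (Γ : Set ((Fin m → ℝ) × (Fin m → ℝ))) : Prop :=
  ∀ p : ℕ → (Fin m → ℝ) × (Fin m → ℝ), (∀ i, p i ∈ Γ) → ∀ k,
    ∑ i ∈ Finset.range k, (p i).2 ⬝ᵥ ((p (i + 1)).1 - (p i).1)
      + (p k).2 ⬝ᵥ ((p 0).1 - (p k).1) ≤ 0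

/-- The affine function attached to the first `k + 1` pairs of a sequence. -/
def chainAffine (p : ℕ → (Fin m → ℝ) × (Fin m → ℝ)) (k : ℕ) (x : Fin m → ℝ) : ℝ :=
  ∑ i ∈ Finset.range k, (p i).2 ⬝ᵥ ((p (i + 1)).1 - (p i).1) + (p k).2 ⬝ᵥ (x - (p k).1)

/-- Rockafellar's potential of the set `Γ` with base point `p₀`. -/
noncomputable def rockafellarPotential (Γ : Set ((Fin m → ℝ) × (Fin m → ℝ)))
    (p₀ : (Fin m → ℝ) × (Fin m → ℝ)) (x : Fin m → ℝ) : EReal :=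
  ⨆ c : {c : (ℕ → (Fin m → ℝ) × (Fin m → ℝ)) × ℕ // (∀ i, c.1 i ∈ Γ) ∧ c.1 0 = p₀},
    (chainAffine c.1.1 c.1.2 x : EReal)

theorem chainAffine_convexCombo (p : ℕ → (Fin m → ℝ) × (Fin m → ℝ)) (k : ℕ) (x y : Fin m → ℝ)
    {a b : ℝ} (hab : a + b = 1) :
    chainAffine p k (a • x + b • y) = a * chainAffine p k x + b * chainAffine p k y := by
  have hb : b = 1 - a := by linarith
  subst hb
  simp only [chainAffine, dotProduct_sub, dotProduct_add, dotProduct_smul, smul_eq_mul]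
  ring

theorem chainAffine_extend (p : ℕ → (Fin m → ℝ) × (Fin m → ℝ)) (k : ℕ)
    (q : (Fin m → ℝ) × (Fin m → ℝ)) (x : Fin m → ℝ) :
    chainAffine (fun i => if i ≤ k then p i else q) (k + 1) x
      = chainAffine p k q.1 + q.2 ⬝ᵥ (x - q.1) := by
  simp only [chainAffine]
  rw [Finset.sum_range_succ]
  have h : ∀ i ∈ Finset.range k,
      (if i ≤ k then p i else q).2 ⬝ᵥ
        ((if i + 1 ≤ k then p (i + 1) else q).1 - (if i ≤ k then p i else q).1)
      = (p i).2 ⬝ᵥ ((p (i + 1)).1 - (p i).1) := by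
    intro i hi
    have hi' := Finset.mem_range.1 hi
    rw [if_pos hi'.le, if_pos (show i + 1 ≤ k from hi')]
  rw [Finset.sum_congr rfl h]
  simp

theorem rockafellarPotential_ne_bot {Γ : Set ((Fin m → ℝ) × (Fin m → ℝ))}
    {p₀ : (Fin m → ℝ) × (Fin m → ℝ)} (hp₀ : p₀ ∈ Γ) (x : Fin m → ℝ) :
    rockafellarPotential Γ p₀ x ≠ ⊥ := by
  refine ne_of_gt (lt_of_lt_of_le (EReal.bot_lt_coe _)
    (le_iSup (fun c : {c : (ℕ → (Fin m → ℝ) × (Fin m → ℝ)) × ℕ //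
      (∀ i, c.1 i ∈ Γ) ∧ c.1 0 = p₀} => (chainAffine c.1.1 c.1.2 x : EReal))
      ⟨(fun _ => p₀, 0), fun _ => hp₀, rfl⟩))

/-- A chain evaluated at its own starting point closes up into a cycle. -/
theorem rockafellarPotential_base_le {Γ : Set ((Fin m → ℝ) × (Fin m → ℝ))}
    (hΓ : IsCyclicallyMonotone Γ) (p₀ : (Fin m → ℝ) × (Fin m → ℝ)) :
    rockafellarPotential Γ p₀ p₀.1 ≤ 0 := by
  refine iSup_le fun ⟨⟨p, k⟩, hp, hp0⟩ => ?_
  have := hΓ p hp k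
  rw [show p 0 = p₀ from hp0] at this
  exact_mod_cast this

/-- Appending `q` to any chain gives another admissible chain, so the subgradient inequality holds
chain by chain. -/
theorem rockafellarPotential_add_le {Γ : Set ((Fin m → ℝ) × (Fin m → ℝ))}
    {p₀ q : (Fin m → ℝ) × (Fin m → ℝ)} (hq : q ∈ Γ) (x : Fin m → ℝ) :
    rockafellarPotential Γ p₀ q.1 + ((q.2 ⬝ᵥ (x - q.1) : ℝ) : EReal)
      ≤ rockafellarPotential Γ p₀ x := by
  have h : rockafellarPotential Γ p₀ q.1
      ≤ rockafellarPotential Γ p₀ x - ((q.2 ⬝ᵥ (x - q.1) : ℝ) : EReal) := by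
    refine iSup_le fun ⟨⟨p, k⟩, hp, hp0⟩ => ?_
    rw [EReal.le_sub_iff_add_le (Or.inl (EReal.coe_ne_bot _)) (Or.inl (EReal.coe_ne_top _)),
      ← EReal.coe_add, ← chainAffine_extend]
    refine le_iSup (fun c : {c : (ℕ → (Fin m → ℝ) × (Fin m → ℝ)) × ℕ //
      (∀ i, c.1 i ∈ Γ) ∧ c.1 0 = p₀} => (chainAffine c.1.1 c.1.2 x : EReal))
      ⟨(fun i => if i ≤ k then p i else q, k + 1), fun i => ?_, ?_⟩
    · dsimp only
      split_ifs
      exacts [hp i, hq]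
    · simpa using hp0
  rwa [EReal.le_sub_iff_add_le (Or.inl (EReal.coe_ne_bot _)) (Or.inl (EReal.coe_ne_top _))] at h

/-- An infinite value at `q.1` would propagate, by the subgradient inequality, to the base point,
where the potential is at most zero. -/
theorem rockafellarPotential_ne_top {Γ : Set ((Fin m → ℝ) × (Fin m → ℝ))}
    (hΓ : IsCyclicallyMonotone Γ) {p₀ q : (Fin m → ℝ) × (Fin m → ℝ)} (hq : q ∈ Γ) :
    rockafellarPotential Γ p₀ q.1 ≠ ⊤ := by
  intro h
  have := (rockafellarPotential_add_le (p₀ := p₀) hq p₀.1).trans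
    (rockafellarPotential_base_le hΓ p₀)
  rw [h, EReal.top_add_coe] at this
  exact absurd this (by simp)

theorem isProperConvex_rockafellarPotential {Γ : Set ((Fin m → ℝ) × (Fin m → ℝ))}
    (hΓ : IsCyclicallyMonotone Γ) {p₀ : (Fin m → ℝ) × (Fin m → ℝ)} (hp₀ : p₀ ∈ Γ) :
    IsProperConvex (rockafellarPotential Γ p₀) where
  convex_epigraph := by
    rintro ⟨x, s⟩ hx ⟨y, t⟩ hy a b ha hb hab
    simp only [Set.mem_ofPred_eq, rockafellarPotential, iSup_le_iff, EReal.coe_le_coe_iff,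
      Prod.fst_add, Prod.smul_fst, Prod.snd_add, Prod.smul_snd, smul_eq_mul] at hx hy ⊢
    intro c
    rw [chainAffine_convexCombo _ _ _ _ hab]
    exact add_le_add (mul_le_mul_of_nonneg_left (hx c) ha) (mul_le_mul_of_nonneg_left (hy c) hb)
  ne_bot := rockafellarPotential_ne_bot hp₀
  exists_ne_top := ⟨p₀.1, rockafellarPotential_ne_top hΓ hp₀⟩

/-- Rockafellar's theorem: a cyclically monotone set lies in the graph of the subdifferential of a
proper convex function. -/
theorem exists_isProperConvex_mem_subdifferential {Γ : Set ((Fin m → ℝ) × (Fin m → ℝ))}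
    (hΓ : IsCyclicallyMonotone Γ) (hne : Γ.Nonempty) :
    ∃ u : (Fin m → ℝ) → EReal, IsProperConvex u ∧ ∀ q ∈ Γ, q.2 ∈ subdifferential u q.1 := by
  obtain ⟨p₀, hp₀⟩ := hne
  exact ⟨rockafellarPotential Γ p₀, isProperConvex_rockafellarPotential hΓ hp₀, fun q hq =>
    ⟨rockafellarPotential_ne_bot hp₀ _, rockafellarPotential_ne_top hΓ hq,
      rockafellarPotential_add_le hq⟩⟩

/-- Cyclical monotonicity from the permutation inequality for a bilinear cost. -/
theorem isCyclicallyMonotone_image_mulVec (M : Matrix (Fin m) (Fin n) ℝ)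
    {S : Set ((Fin m → ℝ) × (Fin n → ℝ))}
    (hS : ∀ (k : ℕ) (p : Fin (k + 1) → (Fin m → ℝ) × (Fin n → ℝ)), (∀ i, p i ∈ S) →
      ∑ i, (p (finRotate (k + 1) i)).1 ⬝ᵥ (M *ᵥ (p i).2) ≤ ∑ i, (p i).1 ⬝ᵥ (M *ᵥ (p i).2)) :
    IsCyclicallyMonotone ((fun q : (Fin m → ℝ) × (Fin n → ℝ) => (q.1, M *ᵥ q.2)) '' S) := by
  intro p hp k
  choose q hqS hq using hp
  have h := hS k (fun i => q i) fun i => hqS i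
  -- The last index is split off because the rotation sends it to `0`: its term closes the cycle.
  rw [← sub_nonpos, ← Finset.sum_sub_distrib, Fin.sum_univ_castSucc] at h
  simp only [finRotate_last, Fin.val_last, Fin.val_castSucc, Fin.val_zero] at h
  have hrot : ∀ i : Fin k, (finRotate (k + 1) i.castSucc : ℕ) = i + 1 := by
    intro i
    rw [coe_finRotate_of_ne_last (Fin.castSucc_lt_last i).ne, Fin.val_castSucc]
  simp only [hrot] at h
  rw [Fin.sum_univ_eq_sum_range (fun i => (q (i + 1)).1 ⬝ᵥ (M *ᵥ (q i).2)
    - (q i).1 ⬝ᵥ (M *ᵥ (q i).2)) k] at h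
  simp only [← hq]
  simp only [dotProduct_sub]
  simpa only [dotProduct_comm (M *ᵥ _)] using h

end

/-! ### Conjugate potentials and sufficiency of the subdifferential condition. -/

section

variable {m n : ℕ} {P : Measure (Fin m → ℝ)} {Q : Measure (Fin n → ℝ)}
  {π : Measure ((Fin m → ℝ) × (Fin n → ℝ))}

/-- The convex conjugate, as a supremum of finite affine functions over the effective domain. -/
noncomputable def convexConjugate (u : (Fin m → ℝ) → EReal) (z : Fin m → ℝ) : EReal :=
  ⨆ x : {x // u x ≠ ⊤}, ((x.1 ⬝ᵥ z - (u x.1).toReal : ℝ) : EReal)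

/-- A supremum of continuous functions is lower semicontinuous, whatever `u` is. Conjugates thus
supply measurable potentials although `u` itself need not be measurable. -/
theorem measurable_convexConjugate (u : (Fin m → ℝ) → EReal) :
    Measurable (convexConjugate u) := by
  refine LowerSemicontinuous.measurable (lowerSemicontinuous_iSup fun x => ?_)
  refine (continuous_coe_real_ereal.comp ?_).lowerSemicontinuous
  simp only [dotProduct]
  fun_prop

theorem le_convexConjugate {u : (Fin m → ℝ) → EReal} {x : Fin m → ℝ} (hx : u x ≠ ⊤)
    (z : Fin m → ℝ) : ((x ⬝ᵥ z - (u x).toReal : ℝ) : EReal) ≤ convexConjugate u z :=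
  le_iSup (fun x : {x // u x ≠ ⊤} => ((x.1 ⬝ᵥ z - (u x.1).toReal : ℝ) : EReal)) ⟨x, hx⟩

theorem le_toReal_convexConjugate {u : (Fin m → ℝ) → EReal} {x z : Fin m → ℝ} (hx : u x ≠ ⊤)
    (hz : convexConjugate u z ≠ ⊤) : x ⬝ᵥ z - (u x).toReal ≤ (convexConjugate u z).toReal := by
  have h := EReal.toReal_le_toReal (le_convexConjugate hx z) (EReal.coe_ne_bot _) hz
  rwa [EReal.toReal_coe] at h

theorem convexConjugate_eq_of_mem_subdifferential {u : (Fin m → ℝ) → EReal}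
    {x z : Fin m → ℝ} (h : z ∈ subdifferential u x) :
    convexConjugate u z = ((x ⬝ᵥ z - (u x).toReal : ℝ) : EReal) := by
  obtain ⟨hbot, htop, hle⟩ := h
  refine le_antisymm (iSup_le fun ⟨y, hy⟩ => ?_) (le_convexConjugate htop z)
  have h1 := hle y
  rw [← EReal.coe_toReal htop hbot, ← EReal.coe_add] at h1
  have h2 := EReal.toReal_le_toReal h1 (EReal.coe_ne_bot _) hy
  rw [EReal.toReal_coe, dotProduct_sub, dotProduct_comm z, dotProduct_comm z] at h2
  exact EReal.coe_le_coe_iff.2 (by linarith)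

/-- The subgradient `z` attains the supremum defining the biconjugate, so the measurable biconjugate
can replace `u` wherever a subgradient exists. -/
theorem convexConjugate_convexConjugate_eq_of_mem_subdifferential {u : (Fin m → ℝ) → EReal}
    {x z : Fin m → ℝ} (h : z ∈ subdifferential u x) :
    convexConjugate (convexConjugate u) x = ((u x).toReal : EReal) := by
  have hz := convexConjugate_eq_of_mem_subdifferential h
  refine le_antisymm (iSup_le fun ⟨y, hy⟩ => ?_) ?_
  · have := le_toReal_convexConjugate h.2.1 hy
    rw [dotProduct_comm] at this
    exact EReal.coe_le_coe_iff.2 (by linarith)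
  · refine le_trans (le_of_eq ?_) (le_convexConjugate (x := z) (hz ▸ EReal.coe_ne_top _) x)
    rw [hz, EReal.toReal_coe, dotProduct_comm]
    simp

theorem MeasureTheory.Integrable.of_le_of_le {α : Type*} [MeasurableSpace α] {μ : Measure α}
    {f g h : α → ℝ} (hf : AEStronglyMeasurable f μ) (hg : Integrable g μ) (hh : Integrable h μ)
    (hgf : ∀ᵐ a ∂μ, g a ≤ f a) (hfh : ∀ᵐ a ∂μ, f a ≤ h a) : Integrable f μ := by
  refine (hg.abs.add hh.abs).mono' hf ?_
  filter_upwards [hgf, hfh] with a h1 h2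
  rw [Real.norm_eq_abs, Pi.add_apply, abs_le]
  constructor
  · linarith [neg_abs_le (g a), abs_nonneg (h a)]
  · linarith [le_abs_self (h a), abs_nonneg (g a)]

/-- Weak duality: a coupling on which a pair of potentials is tight is optimal. -/
theorem integral_le_of_dual_potentials {c : (Fin m → ℝ) × (Fin n → ℝ) → ℝ}
    {f : (Fin m → ℝ) → ℝ} {g : (Fin n → ℝ) → ℝ} {A : Set (Fin m → ℝ)} {B : Set (Fin n → ℝ)}
    (hf : Measurable f) (hg : Measurable g) (hA : MeasurableSet A) (hB : MeasurableSet B)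
    (hint : ∀ π' ∈ couplings P Q, Integrable c π') (hπ : π ∈ couplings P Q)
    (hfi : Integrable (fun p : (Fin m → ℝ) × (Fin n → ℝ) => f p.1) π)
    (hgi : Integrable (fun p : (Fin m → ℝ) × (Fin n → ℝ) => g p.2) π)
    (hπA : ∀ᵐ p ∂π, p.1 ∈ A) (hπB : ∀ᵐ p ∂π, p.2 ∈ B)
    (hle : ∀ x ∈ A, ∀ y ∈ B, c (x, y) ≤ f x + g y) (heq : ∀ᵐ p ∂π, c p = f p.1 + g p.2)
    {π' : Measure ((Fin m → ℝ) × (Fin n → ℝ))} (hπ' : π' ∈ couplings P Q) :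
    ∫ p, c p ∂π' ≤ ∫ p, c p ∂π := by
  have mp1 := measurePreserving_fst_of_mem_couplings hπ
  have mp2 := measurePreserving_snd_of_mem_couplings hπ
  have mp1' := measurePreserving_fst_of_mem_couplings hπ'
  have mp2' := measurePreserving_snd_of_mem_couplings hπ'
  have hfP : Integrable f P := (mp1.integrable_comp hf.aestronglyMeasurable).1 hfi
  have hgQ : Integrable g Q := (mp2.integrable_comp hg.aestronglyMeasurable).1 hgi
  -- Full mass of `A` and `B` is a property of the marginals, so it passes from `π` to `π'`.
  have hAP : ∀ᵐ x ∂P, x ∈ A := by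
    rw [← mp1.map_eq]
    exact (ae_map_iff measurable_fst.aemeasurable hA).2 hπA
  have hBQ : ∀ᵐ y ∂Q, y ∈ B := by
    rw [← mp2.map_eq]
    exact (ae_map_iff measurable_snd.aemeasurable hB).2 hπB
  have hfi' : Integrable (fun p : (Fin m → ℝ) × (Fin n → ℝ) => f p.1) π' :=
    mp1'.integrable_comp_of_integrable hfP
  have hgi' : Integrable (fun p : (Fin m → ℝ) × (Fin n → ℝ) => g p.2) π' :=
    mp2'.integrable_comp_of_integrable hgQ
  have e1 : ∀ {ρ}, ρ ∈ couplings P Q → ∫ p, f p.1 ∂ρ = ∫ x, f x ∂P := fun {ρ} hρ => by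
    rw [← hρ.2.1, integral_map measurable_fst.aemeasurable hf.aestronglyMeasurable]
  have e2 : ∀ {ρ}, ρ ∈ couplings P Q → ∫ p, g p.2 ∂ρ = ∫ y, g y ∂Q := fun {ρ} hρ => by
    rw [← hρ.2.2, integral_map measurable_snd.aemeasurable hg.aestronglyMeasurable]
  calc ∫ p, c p ∂π' ≤ ∫ p, (f p.1 + g p.2) ∂π' := by
        refine integral_mono_ae (hint _ hπ') (hfi'.add hgi') ?_
        filter_upwards [mp1'.quasiMeasurePreserving.ae hAP, mp2'.quasiMeasurePreserving.ae hBQ]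
          with p h1 h2
        exact hle p.1 h1 p.2 h2
    _ = ∫ p, (f p.1 + g p.2) ∂π := by
        rw [integral_add hfi' hgi', integral_add hfi hgi, e1 hπ, e1 hπ', e2 hπ, e2 hπ']
    _ = ∫ p, c p ∂π := integral_congr_ae (heq.mono fun p hp => hp.symm)

/-- The potentials are `φ = u**` and `ψ = u*` composed with `M`, tight by the Fenchel equality. The
delicate point is their integrability, since only their sum is known to be integrable. -/
theorem integral_le_of_mem_subdifferential [IsProbabilityMeasure P] [IsProbabilityMeasure Q]
    (hP : ∀ i, MemLp (fun x : Fin m → ℝ => x i) 2 P)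
    (hQ : ∀ j, MemLp (fun y : Fin n → ℝ => y j) 2 Q) (hπ : π ∈ couplings P Q)
    {M : Matrix (Fin m) (Fin n) ℝ} {u : (Fin m → ℝ) → EReal}
    (hu : ∀ᵐ p ∂π, M *ᵥ p.2 ∈ subdifferential u p.1)
    {π' : Measure ((Fin m → ℝ) × (Fin n → ℝ))} (hπ' : π' ∈ couplings P Q) :
    ∫ p, p.1 ⬝ᵥ (M *ᵥ p.2) ∂π' ≤ ∫ p, p.1 ⬝ᵥ (M *ᵥ p.2) ∂π := by
  have := hπ.1
  set ψ := convexConjugate u with hψ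
  set φ := convexConjugate ψ with hφ
  have hψm : Measurable ψ := measurable_convexConjugate u
  have hφm : Measurable φ := measurable_convexConjugate ψ
  have hMm : Measurable fun y : Fin n → ℝ => M *ᵥ y :=
    (Continuous.matrix_mulVec continuous_const continuous_id).measurable
  have hgm : Measurable fun y : Fin n → ℝ => ψ (M *ᵥ y) := hψm.comp hMm
  have hψeq : ∀ᵐ p ∂π, ψ (M *ᵥ p.2) = ((p.1 ⬝ᵥ (M *ᵥ p.2) - (u p.1).toReal : ℝ) : EReal) :=
    hu.mono fun p hp => convexConjugate_eq_of_mem_subdifferential hp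
  have hφeq : ∀ᵐ p ∂π, φ p.1 = ((u p.1).toReal : EReal) :=
    hu.mono fun p hp => convexConjugate_convexConjugate_eq_of_mem_subdifferential hp
  have hφtop : ∀ᵐ p ∂π, φ p.1 ≠ ⊤ := hφeq.mono fun p hp => by simp [hp]
  have hψtop : ∀ᵐ p ∂π, ψ (M *ᵥ p.2) ≠ ⊤ := hψeq.mono fun p hp => by
    rw [hp]
    exact EReal.coe_ne_top _
  have hyoung : ∀ x z, φ x ≠ ⊤ → ψ z ≠ ⊤ → x ⬝ᵥ z ≤ (φ x).toReal + (ψ z).toReal := by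
    intro x z hx hz
    have := le_toReal_convexConjugate hz hx
    rw [dotProduct_comm] at this
    linarith
  have hsum : ∀ᵐ p ∂π, p.1 ⬝ᵥ (M *ᵥ p.2) = (φ p.1).toReal + (ψ (M *ᵥ p.2)).toReal := by
    filter_upwards [hψeq, hφeq] with p h1 h2
    rw [h1, h2, EReal.toReal_coe, EReal.toReal_coe]
    ring
  -- Young's inequality against one point `q` with finite potentials bounds each potential below by
  -- an integrable affine function.
  obtain ⟨q, hq1, hq2⟩ := (hφtop.and hψtop).exists
  have hci := integrable_dotProduct_mulVec hP hQ hπ M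
  have hfst : Integrable (fun p : (Fin m → ℝ) × (Fin n → ℝ) =>
      p.1 ⬝ᵥ (M *ᵥ q.2) - (ψ (M *ᵥ q.2)).toReal) π := by
    refine Integrable.sub ?_ (integrable_const _)
    simp only [dotProduct]
    exact integrable_finsetSum _ fun i _ =>
      ((memLp_fst_apply hP hπ i).integrable one_le_two).mul_const _
  have hsnd : Integrable (fun p : (Fin m → ℝ) × (Fin n → ℝ) =>
      q.1 ⬝ᵥ (M *ᵥ p.2) - (φ q.1).toReal) π := by
    refine Integrable.sub ?_ (integrable_const _)
    simp only [dotProduct_mulVec_eq_sum]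
    exact integrable_finsetSum _ fun i _ => integrable_finsetSum _ fun j _ =>
      (((memLp_snd_apply hQ hπ j).integrable one_le_two).const_mul _).const_mul _
  have hfle : ∀ᵐ p ∂π, p.1 ⬝ᵥ (M *ᵥ q.2) - (ψ (M *ᵥ q.2)).toReal ≤ (φ p.1).toReal := by
    filter_upwards [hφtop] with p hp
    linarith [hyoung p.1 (M *ᵥ q.2) hp hq2]
  have hgle : ∀ᵐ p ∂π, q.1 ⬝ᵥ (M *ᵥ p.2) - (φ q.1).toReal ≤ (ψ (M *ᵥ p.2)).toReal := by
    filter_upwards [hψtop] with p hp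
    linarith [hyoung q.1 (M *ᵥ p.2) hq1 hp]
  -- The upper bound comes from tightness: `φ` is the cost minus the other potential, hence at most
  -- the cost minus the affine minorant of the latter.
  have hfi : Integrable (fun p : (Fin m → ℝ) × (Fin n → ℝ) => (φ p.1).toReal) π := by
    refine Integrable.of_le_of_le
      (hφm.ereal_toReal.comp measurable_fst).aestronglyMeasurable hfst (hci.sub hsnd) hfle ?_
    filter_upwards [hsum, hgle] with p h1 h2
    rw [Pi.sub_apply]
    linarith
  have hgi : Integrable (fun p : (Fin m → ℝ) × (Fin n → ℝ) => (ψ (M *ᵥ p.2)).toReal) π := by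
    refine (hci.sub hfi).congr (hsum.mono fun p hp => ?_)
    rw [Pi.sub_apply]
    linarith
  exact integral_le_of_dual_potentials (f := fun x => (φ x).toReal)
    (g := fun y => (ψ (M *ᵥ y)).toReal) (A := {x | φ x ≠ ⊤}) (B := {y | ψ (M *ᵥ y) ≠ ⊤})
    hφm.ereal_toReal hgm.ereal_toReal
    (hφm (measurableSet_singleton ⊤).compl) (hgm (measurableSet_singleton ⊤).compl)
    (fun _ h => integrable_dotProduct_mulVec hP hQ h M) hπ hfi hgi hφtop hψtop
    (fun x hx y hy => hyoung x (M *ᵥ y) hx hy) hsum hπ'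

/-- Cyclical monotonicity holds on the support of `π`, which is nonempty and has full measure. -/
theorem exists_isProperConvex_of_optimal (hP : ∀ i, MemLp (fun x : Fin m → ℝ => x i) 2 P)
    (hQ : ∀ j, MemLp (fun y : Fin n → ℝ => y j) 2 Q) (hπ : π ∈ couplings P Q)
    {M : Matrix (Fin m) (Fin n) ℝ} (hopt : ∀ π' ∈ couplings P Q,
      ∫ p, p.1 ⬝ᵥ (M *ᵥ p.2) ∂π' ≤ ∫ p, p.1 ⬝ᵥ (M *ᵥ p.2) ∂π) :
    ∃ u : (Fin m → ℝ) → EReal, IsProperConvex u ∧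
      ∀ᵐ p ∂π, M *ᵥ p.2 ∈ subdifferential u p.1 := by
  have := hπ.1
  have hc : Continuous fun p : (Fin m → ℝ) × (Fin n → ℝ) => p.1 ⬝ᵥ (M *ᵥ p.2) := by
    simp only [dotProduct_mulVec_eq_sum]
    fun_prop
  have hmono := isCyclicallyMonotone_image_mulVec M (S := π.support) fun k p hp =>
    sum_cost_perm_le_of_optimal hc (fun _ h => integrable_dotProduct_mulVec hP hQ h M) hπ hopt
      (finRotate (k + 1)) hp
  obtain ⟨u, hu, hmem⟩ := exists_isProperConvex_mem_subdifferential hmono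
    ((Measure.nonempty_support (IsProbabilityMeasure.ne_zero π)).image _)
  refine ⟨u, hu, ?_⟩
  filter_upwards [Measure.support_mem_ae (μ := π)] with p hp
  exact hmem _ (Set.mem_image_of_mem _ hp)

end

/-! ### Assembly of the equivalences. -/

theorem theorem1 {m n : ℕ} (P : Measure (Fin m → ℝ)) (Q : Measure (Fin n → ℝ))
    [IsProbabilityMeasure P] [IsProbabilityMeasure Q]
    (hP : ∀ i, MemLp (fun x : Fin m → ℝ => x i) 2 P)
    (hQ : ∀ j, MemLp (fun y : Fin n → ℝ => y j) 2 Q)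
    (hP0 : ∀ i, ∫ x, x i ∂P = 0) (hQ0 : ∀ j, ∫ y, y j ∂Q = 0)
    (π : Measure ((Fin m → ℝ) × (Fin n → ℝ))) (hπ : π ∈ couplings P Q) :
    (∀ M : Matrix (Fin m) (Fin n) ℝ,
      IsLUB ((fun π' => (Mᵀ * crossCov π').trace) '' couplings P Q) (Mᵀ * crossCov π).trace ↔
      IsLUB ((fun π' => ∫ p, p.1 ⬝ᵥ (M *ᵥ p.2) ∂π') '' couplings P Q)
        (∫ p, p.1 ⬝ᵥ (M *ᵥ p.2) ∂π)) ∧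
    List.TFAE [
      ExtremeDependence P Q π,
      ∃ M : Matrix (Fin m) (Fin n) ℝ, M ≠ 0 ∧
        IsLUB ((fun π' => (Mᵀ * crossCov π').trace) '' couplings P Q) (Mᵀ * crossCov π).trace,
      ∃ M : Matrix (Fin m) (Fin n) ℝ, M ≠ 0 ∧ ∃ u : (Fin m → ℝ) → EReal,
        IsProperConvex u ∧ ∀ᵐ p ∂π, M *ᵥ p.2 ∈ subdifferential u p.1] := by

  have htr : ∀ M : Matrix (Fin m) (Fin n) ℝ,
      IsLUB ((fun π' => (Mᵀ * crossCov π').trace) '' couplings P Q) (Mᵀ * crossCov π).trace ↔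
      ∀ π' ∈ couplings P Q, (Mᵀ * crossCov π').trace ≤ (Mᵀ * crossCov π).trace := fun M =>
    isLUB_image_iff_of_mem (f := fun π' => (Mᵀ * crossCov π').trace) hπ
  have hE : ∀ M : Matrix (Fin m) (Fin n) ℝ,
      (∀ π' ∈ couplings P Q, (Mᵀ * crossCov π').trace ≤ (Mᵀ * crossCov π).trace) ↔
      ∀ π' ∈ couplings P Q, ∫ p, p.1 ⬝ᵥ (M *ᵥ p.2) ∂π' ≤ ∫ p, p.1 ⬝ᵥ (M *ᵥ p.2) ∂π := fun M => by
    refine forall₂_congr fun π' hπ' => ?_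
    rw [trace_mul_crossCov hP hQ hπ', trace_mul_crossCov hP hQ hπ]
  refine ⟨fun M => ?_, ?_⟩
  · rw [htr, hE]
    exact (isLUB_image_iff_of_mem
      (f := fun π' : Measure ((Fin m → ℝ) × (Fin n → ℝ)) => ∫ p, p.1 ⬝ᵥ (M *ᵥ p.2) ∂π') hπ).symm
  · simp only [htr]
    tfae_have 1 ↔ 2 := extremeDependence_iff hP hQ hπ
    tfae_have 2 → 3 := fun ⟨M, hM0, hM⟩ =>
      ⟨M, hM0, exists_isProperConvex_of_optimal hP hQ hπ ((hE M).1 hM)⟩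
    tfae_have 3 → 2 := fun ⟨M, hM0, u, _, hu⟩ =>
      ⟨M, hM0, (hE M).2 fun _ hπ' => integral_le_of_mem_subdifferential hP hQ hπ hu hπ'⟩
    tfae_finish
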